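/- **Setting.** Let $n,k,d,t\ge 1$ be integers with $t\mid k$, $k\le d$ and $d+t\le n$, and let $\mathcal M>0$ be a file size. At every time, $n$ devices are active. In a repair, $t$ active devices fail and are replaced by $t$ new devices. Each new device (1) collects an amount $\beta$ of data from each of $d$ live (non-failed) devices of its choice; (2) sends to each of the $t-1$ other new devices an amount $\beta'$ of data computed from what it has collected; (3) stores an amount $\alpha$ of data computed from all that it has collected and received. Here $\alpha$ is real, $\beta,\beta'\ge 0$ are real, and the initial $n$ devices store an amount $\alpha$ each, computed from the file. Which devices fail and which live devices are contacted is arbitrary; what devices do may depend on the past repairs and the current one, but not on later ones. Amounts of information are measured in $Q$-ary symbols (an amount at most $c$ means an alphabet of at most $Q^c$ letters). The code with amounts $(\alpha,\beta,\beta')$ is *correct* if for every number $L$ and every $\mathcal M'<\mathcal M$ there are an integer $Q>1$ and a coding scheme as above, for a set of at least $Q^{\mathcal M'}$ files, such that during any succession of at most $L$ repairs, at any time, the file can be recovered without error from the contents of any $k$ active devices. The coordinated regenerating code $(n,k,d,t,\alpha,\gamma)$ is *correct* if the code with amounts $(\alpha,\beta,\beta')$ is correct for some $\beta,\beta'\ge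 0$ with $\gamma=d\beta+(t-1)\beta'$. Write $(\bar\alpha,\bar\gamma)<(\alpha,\gamma)$ if either $\bar\alpha\le\alpha$ and $\bar\gamma<\gamma$, or $\bar\alpha<\alpha$ and $\bar\gamma\le\gamma$. The code $(n,k,d,t,\alpha,\gamma)$ is *optimal* if it is correct and no code $(n,k,d,t,\bar\alpha,\bar\gamma)$ with $(\bar\alpha,\bar\gamma)<(\alpha,\gamma)$ is correct. **Theorem.** Consider, for $\alpha\in\mathbb R$ and $\beta,\beta'\ge0$, the constraints $$\sum_{i=0}^{g-1}u_i\min\Big\{\alpha,\ \Big(d-\sum_{j=0}^{i-1}u_j\Big)\beta+(t-u_i)\beta'\Big\}\ \ge\ \mathcal M\quad\text{for all } g \text{ and all integers } 1\le u_0,\dots,u_{g-1}\le t \text{ with } \sum_{i=0}^{g-1}u_i=k.\tag{$*$}$$ 1. For all real $\alpha$ and all $\beta,\beta'\ge 0$, the code with amounts $(\alpha,\beta,\beta')$ is correct if and only if $(*)$ holds. 2. For all real $\alpha,\gamma$, the coordinated regenerating code $(n,k,d,t,\alpha,\gamma)$ is correct if and only if there are $\beta,\beta'\ge 0$ with $\gamma=d\beta+(t-1)\beta'$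 that satisfy $(*)$. 3. If $(\alpha,\gamma)$ is minimal, with respect to the order $<$ above, among the pairs for which there are $\beta,\beta'\ge 0$ with $\gamma=d\beta+(t-1)\beta'$ that satisfy $(*)$, then the code $(n,k,d,t,\alpha,\gamma)$ is optimal. -/

import Mathlib

/-- One repair in a system of `n` device slots. The devices in the `t` slots `failed` fail and are
replaced by `t` new devices, which take over these slots; the new device of slot `s ∈ failed`
contacts the `d` live (non-failed) devices of the slots `helpers s`. Different new devices may
contact different live devices. (The values of `helpers` outside `failed` are never used.) -/
structure Repair (n d t : ℕ) where
  failed : Finset (Fin n)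
  helpers : Fin n → Finset (Fin n)
  card_failed : failed.card = t
  card_helpers : ∀ s ∈ failed, (helpers s).card = d
  helpers_live : ∀ s ∈ failed, Disjoint (helpers s) failed

/-- A coding scheme for a system of `n` devices with repairs of `t` devices from `d` live ones.
`X` is the set of possible files, `A` the alphabet of the contents of a device, `B` the alphabet of
the data collected from one live device, `C` the alphabet of the data exchanged between two new
devices while they coordinate. All operations may depend on the repairs performed so far (a list,
the most recent repair first) and on the current repair, never on later ones. -/
structure CodingScheme (n d t : ℕ) (X A B C : Type) where
  /-- what the initial device in a given slot stores of the file -/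
  init : Fin n → X → A
  /-- collect: what a live device `p` sends to a new device `s`, given the contents of `p` -/
  collect : List (Repair n d t) → Repair n d t → (p s : Fin n) → A → B
  /-- coordinate: what a new device `q` sends to another new device `s`,
  given all that `q` has collected -/
  coordinate : List (Repair n d t) → (r : Repair n d t) → (q s : Fin n) →
    ({p // p ∈ r.helpers q} → B) → C
  /-- store: what a new device `s` stores, given all that it has collected and all that it has
  received from the other new devices -/
  store : List (Repair n d t) → (r : Repair n d t) → (s : Fin n) →
    ({p // p ∈ r.helpers s} → B) → ({q // q ∈ r.failed.erase s} → C) → A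

/-- The contents of the devices in the `n` slots after the given repairs (the most recent repair
first), when the stored file is `x`. -/
def CodingScheme.contents {n d t : ℕ} {X A B C : Type} (S : CodingScheme n d t X A B C) (x : X) :
    List (Repair n d t) → Fin n → A
  | [], s => S.init s x
  | r :: h, s =>
    if s ∈ r.failed then
      S.store h r s
        (fun p => S.collect h r p s (S.contents x h p))
        (fun q => S.coordinate h r q s
          (fun p => S.collect h r p q (S.contents x h p)))
    else S.contents x h s

/-- A data collector that connects to any `k` of the current devices recovers the file, at any time
during any succession of at most `L` repairs. -/
def CodingScheme.Recovers {n d t : ℕ} {X A B C : Type} (S : CodingScheme n d t X A B C)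
    (k L : ℕ) : Prop :=
  ∀ h : List (Repair n d t), h.length ≤ L →
    ∀ K : Finset (Fin n), K.card = k →
      ∃ decode : ({s // s ∈ K} → A) → X, ∀ x : X, decode (fun s => S.contents x h s) = x

/-- The coordinated regenerating code in which devices store `α`, collect `β` from each of `d` live
devices, and exchange `β'` with each of the `t - 1` other new devices, is correct for files of
size `M`: after any succession of repairs, the file can be recovered from any `k` devices.

Amounts of information are real numbers, in units of one `Q`-ary symbol for a sufficiently large
`Q` (only the ratios of the amounts matter): an alphabet carries an amount at most `c` if it has at
most `Q ^ c` letters. As usual with real amounts, a file size `M` is supported if every file size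
`M' < M` is, with a suitable `Q`. -/
def IsCorrectWith (n k d t : ℕ) (M α β β' : ℝ) : Prop :=
  ∀ L : ℕ, ∀ M' < M, ∃ Q N a b c : ℕ, 1 < Q ∧
    (Q : ℝ) ^ M' ≤ N ∧ (a : ℝ) ≤ (Q : ℝ) ^ α ∧ (b : ℝ) ≤ (Q : ℝ) ^ β ∧ (c : ℝ) ≤ (Q : ℝ) ^ β' ∧
    ∃ S : CodingScheme n d t (Fin N) (Fin a) (Fin b) (Fin c), S.Recovers k L

/-- `β` and `β'` are amounts that are transferred in a repair at a cost of `γ` per new device. -/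
def IsRepairCost (d t : ℕ) (γ β β' : ℝ) : Prop :=
  0 ≤ β ∧ 0 ≤ β' ∧ γ = d * β + ((t : ℝ) - 1) * β'

/-- Correctness of the coordinated regenerating code `(n, k, d, t, α, γ)` for files of size `M`. -/
def IsCorrect (n k d t : ℕ) (M α γ : ℝ) : Prop :=
  ∃ β β' : ℝ, IsRepairCost d t γ β β' ∧ IsCorrectWith n k d t M α β β'

/-- `(a', b') < (a, b)`: one entry is smaller, and the other one is not larger. -/
def PairLT (a' b' a b : ℝ) : Prop :=
  (a' ≤ a ∧ b' < b) ∨ (a' < a ∧ b' ≤ b)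

/-- Optimality of the coordinated regenerating code `(n, k, d, t, α, γ)` for files of size `M`. -/
def IsOptimal (n k d t : ℕ) (M α γ : ℝ) : Prop :=
  IsCorrect n k d t M α γ ∧
    ∀ α' γ' : ℝ, PairLT α' γ' α γ → ¬ IsCorrect n k d t M α' γ'

/-- The family of cut constraints. -/
def CutConstraints (k d t : ℕ) (M α β β' : ℝ) : Prop :=
  ∀ (g : ℕ) (u : Fin g → ℕ), ∑ i, u i = k → (∀ i, 1 ≤ u i ∧ u i ≤ t) →
    M ≤ ∑ i, (u i : ℝ) *
      min α (((d : ℝ) - ∑ j ∈ Finset.Iio i, (u j : ℝ)) * β + ((t : ℝ) - u i) * β')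

/-- The pair `(α, γ)` satisfies the cut constraints, for some `β` and `β'` of cost `γ`. -/
def IsFeasible (k d t : ℕ) (M α γ : ℝ) : Prop :=
  ∃ β β' : ℝ, IsRepairCost d t γ β β' ∧ CutConstraints k d t M α β β'

/-- The pair `(α, γ)` is minimal among the pairs that satisfy the cut constraints. -/
def IsMinimalFeasible (k d t : ℕ) (M α γ : ℝ) : Prop :=
  IsFeasible k d t M α γ ∧
    ∀ α' γ' : ℝ, PairLT α' γ' α γ → ¬ IsFeasible k d t M α' γ'

/-! Necessity is a counting argument. For a list of group sizes with sum `k`, the slots are repaired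
group by group (`exists_cut_repair`), every new device contacting all slots of the earlier groups.
The contents of the earlier slots, together with either the new contents or the messages from
elsewhere, determine the contents of the next group. So the logarithm to base `Q` of the number of
possible contents of the first `k` slots is at most the cut value, while recovery makes it at least
the size of the file (`CodingScheme.exists_numContents_le`).

Sufficiency uses linear codes over a large prime field. Files are vectors, devices store values of
linear functionals, and all messages and contents are generic in the span of what they may depend
on. For one repair, `Repair.exists_generic` bounds the dimension spanned by a set of devices from
below by that of a set before the repair plus the value of a cut through the repair. In
`exists_generic_contents` these bounds are chained by an invariant on dimensions that survives every
repair, so one field serves histories of any length.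

The optimization over one repair (`min_le_group_cost`) leaves two extreme cuts, one of which uses a
full group of size `t`. The resulting lists may therefore overshoot `k`. Such lists are not among
the constraints, but their cut values are also at least the file size: the value is concave in each
group size, so groups can be pushed to extremes until `k` is hit exactly or all groups have size 0
or `t`. In the latter case `t ∣ k` excludes overshooting (`CutConstraints.le_cutList_append`).
Finally, real amounts are scaled up and rounded to integers. -/

/-! ### Cut values of lists and their concavity -/

/-- The cut value of a list of group sizes, when `s` devices have been counted already. -/
def cutList (d t α β β' : ℝ) : ℝ → List ℕ → ℝ
  | _, [] => 0
  | s, w :: l => w * min α ((d - s) * β + (t - w) * β') + cutList d t α β β' (s + w) l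

/-- The cut value in natural numbers, with truncated subtraction. -/
def cutListNat (d t A B C : ℕ) : ℕ → List ℕ → ℕ
  | _, [] => 0
  | s, w :: l => w * min A ((d - s) * B + (t - w) * C) + cutListNat d t A B C (s + w) l

theorem Fin.sum_Iio_succ {g : ℕ} (v : Fin (g + 1) → ℝ) (i : Fin g) :
    ∑ j ∈ Finset.Iio i.succ, v j = v 0 + ∑ j ∈ Finset.Iio i, v j.succ := by
  have h : ∀ {m : ℕ} (i : Fin m) (w : Fin m → ℝ),
      ∑ j ∈ Finset.Iio i, w j = ∑ j, if j < i then w j else 0 := by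
    intro m i w
    rw [← Finset.sum_filter]
    congr 1
    ext j
    simp
  rw [h, h, Fin.sum_univ_succ]
  simp

theorem cutList_ofFn (d t α β β' : ℝ) {g : ℕ} (u : Fin g → ℕ) (s : ℝ) :
    cutList d t α β β' s (List.ofFn u) = ∑ i, (u i : ℝ) *
      min α ((d - s - ∑ j ∈ Finset.Iio i, (u j : ℝ)) * β + (t - u i) * β') := by
  induction g generalizing s with
  | zero => simp [cutList]
  | succ g ih =>
    rw [List.ofFn_succ, cutList, ih, Fin.sum_univ_succ]
    congr 1
    · have : Finset.Iio (0 : Fin (g + 1)) = ∅ := by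
        ext j; simp
      simp [this]
    · refine Finset.sum_congr rfl fun i _ => ?_
      rw [Fin.sum_Iio_succ (fun j => (u j : ℝ)) i]
      congr 3
      ring

theorem cutConstraints_iff_list (k d t : ℕ) (M α β β' : ℝ) :
    CutConstraints k d t M α β β' ↔ ∀ l : List ℕ, l.sum = k → (∀ w ∈ l, 1 ≤ w ∧ w ≤ t) →
      M ≤ cutList d t α β β' 0 l := by
  constructor
  · intro h l hl hw
    have := h l.length l.get (by rw [← List.sum_ofFn, List.ofFn_get, hl])
      (fun i => hw _ (List.get_mem _ _))
    have e := cutList_ofFn d t α β β' l.get 0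
    rw [List.ofFn_get] at e
    rw [e]
    simpa using this
  · intro h g u hu hw
    have := h (List.ofFn u) (by rw [List.sum_ofFn, hu]) (by
      intro w hw'
      obtain ⟨i, rfl⟩ := (List.mem_ofFn' _ _).1 hw'
      exact hw i)
    rw [cutList_ofFn] at this
    simpa using this

theorem cutList_append (d t α β β' s : ℝ) (l l' : List ℕ) :
    cutList d t α β β' s (l ++ l') =
      cutList d t α β β' s l + cutList d t α β β' (s + l.sum) l' := by
  induction l generalizing s with
  | nil => simp [cutList]
  | cons w l ih => simp [cutList, ih, add_assoc]

/-- Each term is a nonnegative multiple of the minimum of a constant and an affine function of the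
offset. -/
theorem concaveOn_cutList {d t α β β' : ℝ} (l : List ℕ) (s : ℝ) :
    ConcaveOn ℝ Set.univ fun x : ℝ => cutList d t α β β' (s + x) l := by
  induction l generalizing s with
  | nil => exact concaveOn_const 0 convex_univ
  | cons w l ih =>
    have h1 : ConcaveOn ℝ Set.univ fun x : ℝ =>
        min α ((d - (s + x)) * β + (t - w) * β') := by
      refine (concaveOn_const α convex_univ).inf ⟨convex_univ, ?_⟩
      intro x _ y _ a b _ _ hab
      simp only [smul_eq_mul]
      obtain rfl : b = 1 - a := by linarith
      apply le_of_eq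
      ring
    have h2 := (h1.smul (c := (w : ℝ)) (by positivity)).add (ih (s + w))
    refine h2.congr fun x _ => ?_
    simp only [cutList, Pi.add_apply, smul_eq_mul]
    congr 2
    ring

/-- For `x ≥ 0` the factor moves into the minimum, which is then between a linear function and a
quadratic one with leading coefficient `-β' ≤ 0`. -/
theorem concaveOn_cut_part {c t α β' : ℝ} (hβ' : 0 ≤ β') :
    ConcaveOn ℝ (Set.Ici 0) fun x : ℝ => x * min α (c + (t - x) * β') := by
  have h1 : ConcaveOn ℝ (Set.Ici (0 : ℝ)) fun x : ℝ => min (x * α) (x * (c + (t - x) * β')) := by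
    refine ConcaveOn.inf ⟨convex_Ici 0, ?_⟩ ⟨convex_Ici 0, ?_⟩
    · intro x _ y _ a b _ _ hab
      simp only [smul_eq_mul]
      apply le_of_eq
      ring
    · intro x _ y _ a b ha hb hab
      simp only [smul_eq_mul]
      obtain rfl : b = 1 - a := by linarith
      nlinarith [mul_nonneg (mul_nonneg ha hb) (mul_nonneg (sq_nonneg (x - y)) hβ')]
  refine h1.congr fun x hx => ?_
  simp only
  rw [mul_min_of_nonneg _ _ hx]

/-- Changing one group size changes the cut value by a concave function. -/
theorem min_cutList_le {d t α β β' : ℝ} (hβ' : 0 ≤ β') (p q : List ℕ) {s : ℝ}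
    {x lo hi : ℕ} (hlo : lo ≤ x) (hhi : x ≤ hi) :
    min (cutList d t α β β' s (p ++ lo :: q)) (cutList d t α β β' s (p ++ hi :: q)) ≤
      cutList d t α β β' s (p ++ x :: q) := by
  have h1 : ConcaveOn ℝ (Set.Ici (0 : ℝ)) fun x : ℝ =>
      x * min α ((d - (s + p.sum)) * β + (t - x) * β') +
        cutList d t α β β' (s + p.sum + x) q :=
    (concaveOn_cut_part hβ').add
      ((concaveOn_cutList q (s + p.sum)).subset (Set.subset_univ _) (convex_Ici 0))
  have h2 := h1.min_le_of_mem_Icc (x := (lo : ℝ)) (y := hi) (z := x)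
    (by simp) (by simp) ⟨by exact_mod_cast hlo, by exact_mod_cast hhi⟩
  simp only [cutList_append, cutList]
  rw [min_add_add_left]
  exact add_le_add_right h2 _

theorem cutList_filter (d t α β β' s : ℝ) (l : List ℕ) :
    cutList d t α β β' s (l.filter (0 < ·)) = cutList d t α β β' s l := by
  induction l generalizing s with
  | nil => rfl
  | cons w l ih =>
    rcases Nat.eq_zero_or_pos w with rfl | hw
    · simp [cutList, ih]
    · simp [hw, cutList, ih]

theorem List.sum_filter_pos (l : List ℕ) : (l.filter (0 < ·)).sum = l.sum := by
  induction l with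
  | nil => rfl
  | cons w l ih =>
    rcases Nat.eq_zero_or_pos w with rfl | hw
    · simp [ih]
    · simp [hw, ih]

/-- Empty groups contribute nothing and do not shift the offset, so they may be allowed. They arise
when groups are shrunk. -/
theorem CutConstraints.le_cutList {k d t : ℕ} {M α β β' : ℝ}
    (h : CutConstraints k d t M α β β') {l : List ℕ} (hl : l.sum = k) (hw : ∀ w ∈ l, w ≤ t) :
    M ≤ cutList d t α β β' 0 l := by
  rw [← cutList_filter]
  refine (cutConstraints_iff_list k d t M α β β').1 h _ (by rw [List.sum_filter_pos, hl]) ?_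
  intro w hm
  simp only [List.mem_filter, decide_eq_true_eq] at hm
  exact ⟨hm.2, hw w hm.1⟩

theorem cutList_singleton_nonneg {d t s w : ℕ} {α β β' : ℝ} (hα : 0 ≤ α) (hβ : 0 ≤ β)
    (hβ' : 0 ≤ β') (hs : s ≤ d) (hw : w ≤ t) : 0 ≤ cutList d t α β β' s [w] := by
  have h1 : (0 : ℝ) ≤ d - s := sub_nonneg.2 (by exact_mod_cast hs)
  have h2 : (0 : ℝ) ≤ t - w := sub_nonneg.2 (by exact_mod_cast hw)
  simp only [cutList]
  positivity

/-- The cut constraints also bound the cuts whose last group overshoots `k`. -/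
theorem CutConstraints.le_cutList_append {k d t : ℕ} {M α β β' : ℝ}
    (h : CutConstraints k d t M α β β') (hkd : k ≤ d) (htk : t ∣ k) (hα : 0 ≤ α) (hβ : 0 ≤ β)
    (hβ' : 0 ≤ β') (p : List ℕ) (w : ℕ) (hw : ∀ x ∈ p ++ [w], x ≤ t) (h1 : p.sum ≤ k)
    (h2 : k ≤ p.sum + w) : M ≤ cutList d t α β β' 0 (p ++ [w]) := by
  -- Induction on the number of groups of size strictly between 0 and `t`.
  induction hc : (p ++ [w]).countP (fun x => x ≠ 0 ∧ x ≠ t) using Nat.strong_induction_on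
    generalizing p w with
  | _ c ih =>
  have key : ∀ (p' : List ℕ) (w' : ℕ), (∀ x ∈ p' ++ [w'], x ≤ t) → p'.sum ≤ k →
      k ≤ p'.sum + w' → (p'.sum = k ∨ p'.sum + w' = k ∨
        (p' ++ [w']).countP (fun x => x ≠ 0 ∧ x ≠ t) < c) →
      M ≤ cutList d t α β β' 0 (p' ++ [w']) := by
    rintro p' w' hw' h1' h2' (e | e | e)
    · rw [cutList_append, zero_add]
      have := h.le_cutList e fun x hx => hw' x (by simp [hx])
      have := cutList_singleton_nonneg hα hβ hβ' (h1'.trans hkd) (hw' w' (by simp))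
      linarith
    · exact h.le_cutList (by simpa using e) hw'
    · exact ih _ e p' w' hw' h1' h2' rfl
  have hwt : w ≤ t := hw w (by simp)
  have hp : ∀ x ∈ p, x ≤ t := fun x hx => hw x (by simp [hx])
  by_cases e1 : p.sum = k
  · exact key p w hw h1 h2 (.inl e1)
  by_cases e2 : p.sum + w = k
  · exact key p w hw h1 h2 (.inr (.inl e2))
  by_cases e3 : w = t
  · subst e3
    by_cases e4 : ∃ x ∈ p, x ≠ 0 ∧ x ≠ w
    · obtain ⟨x, hx, hx0, hxt⟩ := e4
      obtain ⟨p₁, p₂, rfl⟩ := List.append_of_mem hx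
      have hxt' := hp x hx
      simp only [List.append_assoc, List.cons_append, List.sum_append, List.sum_cons] at *
      have hmem : ∀ y ≤ w, ∀ z ∈ p₁ ++ y :: (p₂ ++ [w]), z ≤ w := by
        intro y hy z hz
        simp only [List.mem_append, List.mem_cons] at hz
        rcases hz with hz | rfl | hz
        · exact hp z (by simp [hz])
        · exact hy
        · exact hw z (by simp only [List.mem_append, List.mem_cons]; tauto)
      have hcount : ∀ y, y = 0 ∨ y = w →
          (p₁ ++ y :: (p₂ ++ [w])).countP (fun x => x ≠ 0 ∧ x ≠ w) < c := by
        intro y hy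
        rw [← hc, List.countP_append, List.countP_append, List.countP_cons, List.countP_cons]
        rcases hy with rfl | rfl <;> simp [hx0, hxt]
      -- Shrink `x` until it is 0 or the total is `k`; enlarge it until it is `t` or the sum without
      -- the last group is `k`. Each end hits `k` or has fewer intermediate groups.
      refine le_trans (le_min ?_ ?_) (min_cutList_le hβ' p₁ (p₂ ++ [w])
        (lo := x - (p₁.sum + (x + p₂.sum) + w - k)) (x := x)
        (hi := min w (x + (k - (p₁.sum + (x + p₂.sum))))) (by omega) (by omega))
      · have := key (p₁ ++ (x - (p₁.sum + (x + p₂.sum) + w - k)) :: p₂) w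
        simp only [List.append_assoc, List.cons_append, List.sum_append, List.sum_cons] at this
        refine this (hmem _ (by omega)) (by omega) (by omega) ?_
        by_cases e5 : x - (p₁.sum + (x + p₂.sum) + w - k) = 0
        · exact .inr (.inr (hcount _ (.inl e5)))
        · exact .inr (.inl (by omega))
      · have := key (p₁ ++ (min w (x + (k - (p₁.sum + (x + p₂.sum))))) :: p₂) w
        simp only [List.append_assoc, List.cons_append, List.sum_append, List.sum_cons] at this
        refine this (hmem _ (by omega)) (by omega) (by omega) ?_
        by_cases e5 : min w (x + (k - (p₁.sum + (x + p₂.sum)))) = w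
        · exact .inr (.inr (hcount _ (.inr e5)))
        · exact .inl (by omega)
    -- All sizes are 0 or `t`, so `k` would lie strictly between two consecutive multiples of `t`.
    · push Not at e4
      have hdvd : w ∣ p.sum := List.dvd_sum fun x hx => by
        by_cases hx0 : x = 0
        · simp [hx0]
        · simp [e4 x hx hx0]
      obtain ⟨a, ha⟩ := hdvd
      obtain ⟨b, hb⟩ := htk
      exfalso
      have l1 : w * a < w * b := by omega
      have l2 : w * b < w * (a + 1) := by rw [mul_add, mul_one]; omega
      have l3 := lt_of_mul_lt_mul_left' l1
      have l4 := lt_of_mul_lt_mul_left' l2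
      omega
  · have hmem : ∀ y ≤ t, ∀ z ∈ p ++ [y], z ≤ t := by
      intro y hy z hz
      rcases List.mem_append.1 hz with hz | hz
      · exact hp z hz
      · rw [List.mem_singleton.1 hz]; exact hy
    -- The last group itself is intermediate: shrink it to hit `k`, or enlarge it to `t`.
    refine le_trans (le_min ?_ ?_) (min_cutList_le hβ' p [] (lo := k - p.sum) (hi := t)
      (by omega) hwt)
    · exact key p (k - p.sum) (hmem _ (by omega)) h1 (by omega) (.inr (.inl (by omega)))
    · refine key p t (hmem _ le_rfl) h1 (by omega) (.inr (.inr ?_))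
      rw [← hc, List.countP_append, List.countP_append]
      have : w ≠ 0 := by omega
      simp [e3, this]

/-! ### Integer amounts and lists that reach or pass `k` -/

theorem cutList_le_cutListNat (d t A B C s : ℕ) (l : List ℕ) :
    cutList d t A B C s l ≤ cutListNat d t A B C s l := by
  induction l generalizing s with
  | nil => simp [cutList, cutListNat]
  | cons w l ih =>
    have h1 : ∀ a b : ℕ, (a : ℝ) - b ≤ (a - b : ℕ) := fun a b => by
      rw [sub_le_iff_le_add]; exact_mod_cast le_tsub_add
    have := ih (s + w)
    simp only [cutList, cutListNat]
    push_cast at this ⊢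
    gcongr
    · exact h1 d s
    · exact h1 t w

theorem cutListNat_append (d t A B C s : ℕ) (l l' : List ℕ) :
    cutListNat d t A B C s (l ++ l') =
      cutListNat d t A B C s l + cutListNat d t A B C (s + l.sum) l' := by
  induction l generalizing s with
  | nil => simp [cutListNat]
  | cons w l ih => simp [cutListNat, ih, add_assoc]

theorem List.exists_split_sum {k : ℕ} (l : List ℕ) (s : ℕ) (h : s < k) (h' : k ≤ s + l.sum) :
    ∃ p w q, l = p ++ w :: q ∧ s + p.sum < k ∧ k ≤ s + p.sum + w := by
  induction l generalizing s with
  | nil => simp at h'; omega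
  | cons x l ih =>
    by_cases hx : k ≤ s + x
    · exact ⟨[], x, l, rfl, by simpa using h, by simpa using hx⟩
    · obtain ⟨p, w, q, rfl, h1, h2⟩ := ih (s + x) (by omega) (by simp at h'; omega)
      exact ⟨x :: p, w, q, rfl, by simp; omega, by simp; omega⟩

/-- The list is cut off after the first group that reaches `k`. The groups beyond it, and the
truncation of subtractions, can only raise the value. -/
theorem CutConstraints.le_cutListNat {k d t R A B C : ℕ}
    (h : CutConstraints k d t R A B C) (hk : 0 < k) (hkd : k ≤ d) (htk : t ∣ k) {l : List ℕ}
    (hl : k ≤ l.sum) (hw : ∀ w ∈ l, w ≤ t) : R ≤ cutListNat d t A B C 0 l := by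
  obtain ⟨p, w, q, rfl, h1, h2⟩ := List.exists_split_sum l 0 hk (by simpa using hl)
  have h3 : (R : ℝ) ≤ cutListNat d t A B C 0 (p ++ [w]) := by
    have := cutList_le_cutListNat d t A B C 0 (p ++ [w])
    rw [Nat.cast_zero] at this
    refine le_trans (h.le_cutList_append hkd htk (by positivity) (by positivity) (by positivity)
      p w ?_ (by omega) (by omega)) this
    intro x hx
    refine hw x ?_
    simp only [List.mem_append, List.mem_cons, List.not_mem_nil, or_false] at hx ⊢
    tauto
  have h4 : R ≤ cutListNat d t A B C 0 (p ++ [w]) := by exact_mod_cast h3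
  have h5 : p ++ w :: q = (p ++ [w]) ++ q := by simp
  rw [h5, cutListNat_append]
  omega

theorem cutListNat_antitone (d t A B C : ℕ) {s s' : ℕ} (h : s ≤ s') (l : List ℕ) :
    cutListNat d t A B C s' l ≤ cutListNat d t A B C s l := by
  induction l generalizing s s' with
  | nil => simp [cutListNat]
  | cons w l ih =>
    simp only [cutListNat]
    gcongr ?_ + ?_
    · gcongr
    · exact ih (by omega)

/-- The cost of recovering `u` devices of a group from `a` devices that collect and `b` devices
that are recovered from what they collect and receive. -/
theorem min_le_group_cost {t u m a b x A C : ℕ} (hba : b ≤ a) (hat : a ≤ t) (hbm : b ≤ m)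
    (hum : u ≤ m) :
    min (u * min A (x + (t - u) * C)) (t * min A x) ≤
      a * x + b * (t - a) * C + (m - b) * A := by
  -- Lowering `b` to `min b u` gives `b' ≤ u` and does not raise the cost when `m` is replaced by
  -- `u`.
  obtain ⟨b', hb', hb'a, hb'u, hA⟩ : ∃ b', b' ≤ b ∧ b' ≤ a ∧ b' ≤ u ∧ u - b' ≤ m - b :=
    ⟨min b u, by omega, by omega, by omega, by omega⟩
  have h0 : a * x + b' * (t - a) * C + (u - b') * A ≤
      a * x + b * (t - a) * C + (m - b) * A := by gcongr
  refine le_trans ?_ h0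
  -- The cost is affine in `a` on `[b', t]`, with slope `x - b' * C`; the sign decides whether `a =
  -- b'` or `a = t` is the cheapest.
  by_cases hx : b' * C ≤ x
  · refine (min_le_left _ _).trans ?_
    have h1 : b' * x + b' * (t - b') * C + (u - b') * A ≤
        a * x + b' * (t - a) * C + (u - b') * A := by
      obtain ⟨e, rfl⟩ := Nat.exists_eq_add_of_le hb'a
      obtain ⟨f, rfl⟩ := Nat.exists_eq_add_of_le hat
      have e1 : b' + e + f - b' = e + f := by omega
      have e2 : b' + e + f - (b' + e) = f := by omega
      rw [e1, e2]
      nlinarith [Nat.mul_le_mul_left e hx]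
    refine le_trans ?_ h1
    obtain ⟨e, rfl⟩ := Nat.exists_eq_add_of_le hb'u
    have e1 : b' + e - b' = e := by omega
    rw [e1]
    have h2 : min A (x + (t - (b' + e)) * C) ≤ x + (t - b') * C :=
      (min_le_right _ _).trans (by gcongr)
    have h3 := Nat.mul_le_mul_left b' h2
    have h4 := Nat.mul_le_mul_left e (min_le_left A (x + (t - (b' + e)) * C))
    nlinarith
  · refine (min_le_right _ _).trans ?_
    have h1 : t * min A x ≤ t * x := by gcongr; exact min_le_right _ _
    obtain ⟨f, rfl⟩ := Nat.exists_eq_add_of_le hat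
    have e2 : a + f - a = f := by omega
    rw [e2]
    nlinarith [Nat.mul_le_mul_left f (not_le.1 hx).le]

/-! ### Generic vectors and tuples over a large finite field -/

open Module in
/-- A subspace contains a vector outside of fewer than `|F|` given subspaces, except those that
contain it. -/
theorem Submodule.exists_mem_forall_notMem {F V κ : Type*} [Field F] [Fintype F] [AddCommGroup V]
    [Module F V] [Fintype κ] (Z : Submodule F V) (U : κ → Submodule F V)
    (hc : Fintype.card κ < Fintype.card F) :
    ∃ v ∈ Z, ∀ k, v ∈ U k → Z ≤ U k := by
  classical
  have h := Submodule.iUnion_ssubset_of_forall_ne_top_of_card_lt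
    (Finset.univ : Finset {k // ¬ Z ≤ U k}) (fun k => (U k).comap Z.subtype)
    (fun k hk => k.2 (Submodule.comap_subtype_eq_top.1 hk)) (by
      rw [ENat.card_eq_coe_fintype_card, Nat.cast_lt, Finset.card_univ]
      exact (Fintype.card_subtype_le _).trans_lt hc)
  obtain ⟨v, -, hv⟩ := Set.exists_of_ssubset h
  refine ⟨v, v.2, fun k hk => ?_⟩
  by_contra hZ
  exact hv (Set.mem_biUnion (x := ⟨k, hZ⟩) (Finset.mem_coe.2 (Finset.mem_univ _))
    (show v ∈ Submodule.comap Z.subtype (U k) from hk))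

/-- The subspace spanned by a tuple. -/
def tupleSpan (F : Type*) {V : Type*} [Field F] [AddCommGroup V] [Module F V] {a : ℕ}
    (v : Fin a → V) : Submodule F V :=
  Submodule.span F (Set.range v)

theorem tupleSpan_le {F V : Type*} [Field F] [AddCommGroup V] [Module F V]
    {a : ℕ} {v : Fin a → V} {Z : Submodule F V} (h : ∀ i, v i ∈ Z) :
    tupleSpan F v ≤ Z :=
  Submodule.span_le.2 (by rintro _ ⟨i, rfl⟩; exact h i)

section
open Module
variable {F V : Type*} [Field F] [Fintype F] [AddCommGroup V] [Module F V] [FiniteDimensional F V]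

/-- A generic tuple in `Z`: it raises the dimensions of finitely many subspaces as far as
possible. -/
theorem exists_generic_tuple {κ : Type*} [Fintype κ] (Z : Submodule F V)
    (U : κ → Submodule F V) (hc : Fintype.card κ < Fintype.card F) (a : ℕ) :
    ∃ v : Fin a → V, (∀ i, v i ∈ Z) ∧ ∀ k,
      min (finrank F (U k) + a) (finrank F ↥(U k ⊔ Z)) ≤ finrank F ↥(U k ⊔ tupleSpan F v) := by
  induction a with
  | zero =>
    refine ⟨Fin.elim0, fun i => i.elim0, fun k => (min_le_left _ _).trans ?_⟩
    exact Submodule.finrank_mono le_sup_left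
  | succ a ih =>
    obtain ⟨v, hv, h⟩ := ih
    obtain ⟨w, hw, hwU⟩ := Z.exists_mem_forall_notMem (fun k => U k ⊔ tupleSpan F v) hc
    refine ⟨Fin.cons w v, Fin.cases hw hv, fun k => ?_⟩
    have hspan : tupleSpan F (Fin.cons w v : Fin (a + 1) → V) =
        Submodule.span F {w} ⊔ tupleSpan F v := by
      rw [tupleSpan, Fin.range_cons, Submodule.span_insert, tupleSpan]
    by_cases hk : w ∈ U k ⊔ tupleSpan F v
    · refine (min_le_right _ _).trans (Submodule.finrank_mono ?_)
      refine (sup_le le_sup_left (hwU k hk)).trans (sup_le_sup_left ?_ _)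
      rw [hspan]
      exact le_sup_right
    · have hlt : U k ⊔ tupleSpan F v < U k ⊔ tupleSpan F (Fin.cons w v : Fin (a + 1) → V) := by
        refine lt_of_le_of_ne (sup_le_sup_left (hspan ▸ le_sup_right) _) fun he => hk ?_
        rw [he, hspan]
        exact Submodule.mem_sup_right (Submodule.mem_sup_left (Submodule.mem_span_singleton_self w))
      have := Submodule.finrank_lt_finrank_of_lt hlt
      have := h k
      omega

/-- Generic tuples in several subspaces. Dimensions are as large as the possible cuts allow. -/
theorem exists_generic_tuples {ι : Type} [DecidableEq ι] (Z : ι → Submodule F V) (a : ℕ)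
    (I : Finset ι) {κ : Type} [Fintype κ] (U : κ → Submodule F V)
    (hc : Fintype.card κ * 4 ^ I.card < Fintype.card F) :
    ∃ z : ι → Fin a → V, (∀ i j, z i j ∈ Z i) ∧ ∀ k, ∀ N ⊆ I, ∃ N' ⊆ N,
      finrank F ↥(U k ⊔ N'.sup Z) + (N \ N').card * a ≤
        finrank F ↥(U k ⊔ N.sup fun i => tupleSpan F (z i)) := by
  induction I using Finset.induction_on generalizing κ with
  | empty =>
    refine ⟨fun _ _ => 0, fun i _ => (Z i).zero_mem, fun k N hN => ⟨N, subset_rfl, ?_⟩⟩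
    obtain rfl := Finset.subset_empty.1 hN
    rw [Finset.sdiff_self, Finset.card_empty, zero_mul, add_zero]
    exact Submodule.finrank_mono (by rw [Finset.sup_empty, Finset.sup_empty])
  | insert i I hi ih =>
    rw [Finset.card_insert_of_notMem hi, pow_succ] at hc
    -- The other tuples must be generic relative to both `U k` and `U k ⊔ Z i`, as `i` may lie
    -- outside or inside `N'`.
    obtain ⟨z, hz, h⟩ := ih (κ := κ × Bool) (fun x => cond x.2 (U x.1 ⊔ Z i) (U x.1)) (by
      rw [Fintype.card_prod, Fintype.card_bool]
      nlinarith [Nat.zero_le (Fintype.card κ * 4 ^ I.card)])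
    obtain ⟨v, hv, hvU⟩ := exists_generic_tuple (Z i) (κ := κ × ↥I.powerset)
      (fun x => U x.1 ⊔ x.2.1.sup fun j => tupleSpan F (z j)) (by
        rw [Fintype.card_prod, Fintype.card_coe, Finset.card_powerset]
        refine lt_of_le_of_lt (Nat.mul_le_mul_left _ ?_) hc
        calc 2 ^ I.card ≤ 4 ^ I.card := Nat.pow_le_pow_left (by norm_num) _
          _ ≤ 4 ^ I.card * 4 := by omega) a
    have hsup : ∀ N ⊆ I, (N.sup fun j => tupleSpan F (Function.update z i v j)) =
        N.sup fun j => tupleSpan F (z j) := fun N hN =>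
      Finset.sup_congr rfl fun j hj => by
        rw [Function.update_of_ne]
        rintro rfl
        exact hi (hN hj)
    refine ⟨Function.update z i v, fun j => ?_, fun k N hN => ?_⟩
    · by_cases hj : j = i
      · subst hj; simpa using hv
      · simpa [hj] using hz j
    · by_cases hiN : i ∈ N
      · obtain ⟨N₀, hiN₀, rfl⟩ : ∃ N₀, i ∉ N₀ ∧ insert i N₀ = N :=
          ⟨N.erase i, Finset.notMem_erase i N, Finset.insert_erase hiN⟩
        have hN₀ : N₀ ⊆ I := (Finset.insert_subset_insert_iff hiN₀).1 hN
        have hv' := hvU (k, ⟨N₀, Finset.mem_powerset.2 hN₀⟩)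
        simp only at hv'
        rw [Finset.sup_insert, hsup N₀ hN₀, Function.update_self,
          sup_comm (tupleSpan F v), ← sup_assoc]
        -- Either the new tuple adds its full `a` dimensions, and `i` stays outside `N'`, or it
        -- exhausts `Z i`, and `i` joins `N'`.
        rcases min_le_iff.1 hv' with h1 | h1
        · obtain ⟨N', hN', h2⟩ := h (k, false) N₀ hN₀
          refine ⟨N', hN'.trans (Finset.subset_insert _ _), ?_⟩
          rw [Finset.insert_sdiff_of_notMem _ (fun hh => hiN₀ (hN' hh)),
            Finset.card_insert_of_notMem (by simp [hiN₀]), add_mul, one_mul]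
          simp only [cond_false] at h2
          omega
        · obtain ⟨N', hN', h2⟩ := h (k, true) N₀ hN₀
          refine ⟨insert i N', Finset.insert_subset_insert _ hN', ?_⟩
          rw [Finset.insert_sdiff_insert, Finset.sdiff_insert_of_notMem hiN₀, Finset.sup_insert,
            ← sup_assoc]
          simp only [cond_true] at h2
          rw [sup_right_comm] at h1
          omega
      · have hN' : N ⊆ I := (Finset.subset_insert_iff_of_notMem hiN).1 hN
        rw [hsup N hN']
        simpa using h (k, false) N hN'
end

/-! ### Dimensions after one generic repair -/

section
open Module
variable {F V : Type*} [Field F] [Fintype F] [AddCommGroup V] [Module F V] [FiniteDimensional F V]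

/-- A generic repair. The dimensions after the repair are bounded by cuts: of the failed devices in
`T`, `b` are recovered from the data that `a` new devices collect. -/
theorem Repair.exists_generic {n d t : ℕ} (r : Repair n d t) (σ : Fin n → Submodule F V)
    (A B C : ℕ) (hq : 2 ^ n * 2 ^ (n * n) * 4 ^ (n * n) * 4 ^ n < Fintype.card F) :
    ∃ (c : Fin n × Fin n → Fin B → V) (e : Fin n × Fin n → Fin C → V) (z : Fin n → Fin A → V),
      (∀ x i, c x i ∈ σ x.1) ∧
      (∀ x i, e x i ∈ (r.helpers x.1).sup fun p => tupleSpan F (c (p, x.1))) ∧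
      (∀ s i, z s i ∈ ((r.helpers s).sup fun p => tupleSpan F (c (p, s))) ⊔
        (r.failed.erase s).sup fun q => tupleSpan F (e (q, s))) ∧
      ∀ T : Finset (Fin n), ∃ T' : Finset (Fin n), ∃ a b : ℕ, b ≤ a ∧ a ≤ t ∧
        b ≤ (T ∩ r.failed).card ∧ T \ r.failed ⊆ T' ∧
        finrank F ↥(T'.sup σ) + (a * ((d - T'.card) * B) + b * (t - a) * C +
          ((T ∩ r.failed).card - b) * A) ≤
        finrank F ↥(T.sup fun s => if s ∈ r.failed then tupleSpan F (z s) else σ s) := by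
  have p2 : 1 ≤ 2 ^ (n * n) := Nat.one_le_two_pow
  have p4 : 1 ≤ 4 ^ (n * n) := Nat.one_le_pow _ _ (by norm_num)
  have p5 : 1 ≤ 4 ^ n := Nat.one_le_pow _ _ (by norm_num)
  obtain ⟨c, hc, h1⟩ := exists_generic_tuples (fun x : Fin n × Fin n => σ x.1) B Finset.univ
    (fun P : Finset (Fin n) => P.sup σ) (by
      refine lt_of_le_of_lt ?_ hq
      simp only [Fintype.card_finset, Fintype.card_fin, Finset.card_univ, Fintype.card_prod]
      calc 2 ^ n * 4 ^ (n * n) = 2 ^ n * 1 * 4 ^ (n * n) * 1 := by ring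
        _ ≤ _ := by gcongr)
  obtain ⟨e, he, h2⟩ := exists_generic_tuples
    (fun x : Fin n × Fin n => (r.helpers x.1).sup fun p => tupleSpan F (c (p, x.1)))
    C Finset.univ (fun P : Finset (Fin n) × Finset (Fin n × Fin n) =>
      P.1.sup σ ⊔ P.2.sup fun x => tupleSpan F (c x)) (by
      refine lt_of_le_of_lt ?_ hq
      simp only [Fintype.card_finset, Fintype.card_fin, Finset.card_univ, Fintype.card_prod]
      calc 2 ^ n * 2 ^ (n * n) * 4 ^ (n * n) = 2 ^ n * 2 ^ (n * n) * 4 ^ (n * n) * 1 := by ring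
        _ ≤ _ := by gcongr)
  obtain ⟨z, hz, h3⟩ := exists_generic_tuples
    (fun s : Fin n => ((r.helpers s).sup fun p => tupleSpan F (c (p, s))) ⊔
        (r.failed.erase s).sup fun q => tupleSpan F (e (q, s)))
    A Finset.univ (fun P : Finset (Fin n) => P.sup σ) (by
      refine lt_of_le_of_lt ?_ hq
      simp only [Fintype.card_finset, Fintype.card_fin, Finset.card_univ]
      calc 2 ^ n * 4 ^ n = 2 ^ n * 1 * 1 * 4 ^ n := by ring
        _ ≤ _ := by gcongr)
  refine ⟨c, e, z, hc, he, hz, fun T => ?_⟩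
  -- The cut is traced backwards through storing, exchanging and collecting. `N` consists of the
  -- failed slots of `T` whose storage is not cut; `N₁` and `N₂` are the links into them.
  obtain ⟨N, hN, h3⟩ := h3 (T \ r.failed) (T ∩ r.failed) (Finset.subset_univ _)
  have hNf : N ⊆ r.failed := hN.trans Finset.inter_subset_right
  let N₁ := N.biUnion fun s => r.helpers s ×ˢ {s}
  let N₂ := N.biUnion fun s => r.failed.erase s ×ˢ {s}
  have m1 : ∀ x, x ∈ N₁ ↔ x.2 ∈ N ∧ x.1 ∈ r.helpers x.2 := by
    rintro ⟨p, s⟩; simp [N₁]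
  have m2 : ∀ x, x ∈ N₂ ↔ x.2 ∈ N ∧ x.1 ≠ x.2 ∧ x.1 ∈ r.failed := by
    rintro ⟨p, s⟩; simp [N₂]
  obtain ⟨N₂', hN₂', h2⟩ := h2 (T \ r.failed, N₁) N₂ (Finset.subset_univ _)
  -- The new devices whose collected data are needed: those of `N` and the senders of uncut
  -- exchanges.
  let I := N ∪ N₂'.image Prod.fst
  have hIf : I ⊆ r.failed := by
    refine Finset.union_subset hNf fun q hq => ?_
    obtain ⟨x, hx, rfl⟩ := Finset.mem_image.1 hq
    exact ((m2 x).1 (hN₂' hx)).2.2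
  let N₃ := I.biUnion fun q => r.helpers q ×ˢ {q}
  have m3 : ∀ x, x ∈ N₃ ↔ x.2 ∈ I ∧ x.1 ∈ r.helpers x.2 := by
    rintro ⟨p, s⟩; simp only [N₃, Finset.mem_biUnion, Finset.mem_product, Finset.mem_singleton]
    aesop
  obtain ⟨N₃', hN₃', h1⟩ := h1 (T \ r.failed) N₃ (Finset.subset_univ _)
  let T' := (T \ r.failed) ∪ N₃'.image Prod.fst
  have hNI : N ⊆ I := Finset.subset_union_left
  refine ⟨T', I.card, N.card, Finset.card_le_card hNI,
    (Finset.card_le_card hIf).trans_eq r.card_failed, Finset.card_le_card hN,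
    Finset.subset_union_left, ?_⟩
  have s3 : finrank F ↥((T \ r.failed).sup σ ⊔ (N₁.sup fun x => tupleSpan F (c x)) ⊔
      N₂.sup fun x => tupleSpan F (e x)) ≤ finrank F ↥((T \ r.failed).sup σ ⊔ N.sup fun s =>
        ((r.helpers s).sup fun p => tupleSpan F (c (p, s))) ⊔
        (r.failed.erase s).sup fun q => tupleSpan F (e (q, s))) := by
    refine Submodule.finrank_mono (sup_le (sup_le_sup_left (Finset.sup_le fun x hx => ?_) _)
      (le_sup_of_le_right (Finset.sup_le fun x hx => ?_)))
    · obtain ⟨hx1, hx2⟩ := (m1 x).1 hx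
      exact Finset.le_sup_of_le hx1 (le_sup_of_le_left
        (Finset.le_sup (f := fun p => tupleSpan F (c (p, x.2))) hx2))
    · obtain ⟨hx1, hx2, hx3⟩ := (m2 x).1 hx
      exact Finset.le_sup_of_le hx1 (le_sup_of_le_right
        (Finset.le_sup (f := fun q => tupleSpan F (e (q, x.2))) (Finset.mem_erase.2 ⟨hx2, hx3⟩)))
  have s2 : finrank F ↥((T \ r.failed).sup σ ⊔ N₃.sup fun x => tupleSpan F (c x)) ≤
      finrank F ↥((T \ r.failed).sup σ ⊔ (N₁.sup fun x => tupleSpan F (c x)) ⊔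
      N₂'.sup fun x => (r.helpers x.1).sup fun p => tupleSpan F (c (p, x.1))) := by
    rw [sup_assoc]
    refine Submodule.finrank_mono (sup_le_sup_left (Finset.sup_le fun x hx => ?_) _)
    obtain ⟨hx1, hx2⟩ := (m3 x).1 hx
    rcases Finset.mem_union.1 hx1 with hx1 | hx1
    · exact le_sup_of_le_left (Finset.le_sup (f := fun x => tupleSpan F (c x))
        ((m1 x).2 ⟨hx1, hx2⟩))
    · obtain ⟨y, hy, hyx⟩ := Finset.mem_image.1 hx1
      refine le_sup_of_le_right (Finset.le_sup_of_le hy ?_)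
      rw [hyx]
      exact Finset.le_sup (f := fun p => tupleSpan F (c (p, x.2))) hx2
  have s1 : finrank F ↥(T'.sup σ) ≤
      finrank F ↥((T \ r.failed).sup σ ⊔ N₃'.sup fun x => σ x.1) := by
    refine Submodule.finrank_mono ?_
    rw [Finset.sup_union, Finset.sup_image]
    rfl
  -- A sender outside `I` has all its exchanges with `N` cut.
  have c2 : N.card * (t - I.card) ≤ (N₂ \ N₂').card := by
    rw [← r.card_failed, ← Finset.card_sdiff_of_subset hIf, mul_comm, ← Finset.card_product]
    refine Finset.card_le_card fun x hx => ?_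
    obtain ⟨hx1, hx2⟩ := Finset.mem_product.1 hx
    obtain ⟨hx3, hx4⟩ := Finset.mem_sdiff.1 hx1
    refine Finset.mem_sdiff.2 ⟨(m2 x).2 ⟨hx2, ?_, hx3⟩, fun hx5 => hx4 ?_⟩
    · intro h
      exact hx4 (h ▸ hNI hx2)
    · exact Finset.mem_union_right _ (Finset.mem_image_of_mem _ hx5)
  -- Each device of `I` has `d` helpers, and its links from helpers outside `T'` are all cut.
  have c1 : I.card * (d - T'.card) ≤ (N₃ \ N₃').card := by
    have hsub : (I.biUnion fun q => (r.helpers q \ T') ×ˢ {q}) ⊆ N₃ \ N₃' := by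
      intro x hx
      obtain ⟨q, hq, hx⟩ := Finset.mem_biUnion.1 hx
      obtain ⟨hx1, hx2⟩ := Finset.mem_product.1 hx
      obtain ⟨hx3, hx4⟩ := Finset.mem_sdiff.1 hx1
      obtain rfl := Finset.mem_singleton.1 hx2
      exact Finset.mem_sdiff.2 ⟨(m3 x).2 ⟨hq, hx3⟩, fun hx5 => hx4
        (Finset.mem_union_right _ (Finset.mem_image_of_mem _ hx5))⟩
    refine le_trans ?_ (Finset.card_le_card hsub)
    rw [Finset.card_biUnion, ← smul_eq_mul]
    · refine Finset.card_nsmul_le_sum _ _ _ fun q hq => ?_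
      rw [Finset.card_product, Finset.card_singleton, mul_one]
      exact (r.card_helpers q (hIf hq) ▸ Finset.le_card_sdiff T' (r.helpers q) :)
    · intro q _ q' _ hqq
      refine Finset.disjoint_left.2 fun x hx hx' => hqq ?_
      rw [← Finset.mem_singleton.1 (Finset.mem_product.1 hx).2,
        ← Finset.mem_singleton.1 (Finset.mem_product.1 hx').2]
  have s4 : (T.sup fun s => if s ∈ r.failed then tupleSpan F (z s) else σ s) =
      (T \ r.failed).sup σ ⊔ (T ∩ r.failed).sup fun s => tupleSpan F (z s) := by
    conv_lhs => rw [← Finset.sdiff_union_inter T r.failed, Finset.sup_union]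
    congr 1
    · exact Finset.sup_congr rfl fun s hs => if_neg (Finset.mem_sdiff.1 hs).2
    · exact Finset.sup_congr rfl fun s hs => if_pos (Finset.mem_inter.1 hs).2
  rw [s4]
  have c3 := Nat.mul_le_mul_right B c1
  have c4 := Nat.mul_le_mul_right C c2
  rw [Finset.card_sdiff_of_subset hN] at h3
  rw [mul_assoc] at c3
  simp only at h1 h2 h3
  omega
end

/-! ### Dimensions after any succession of repairs -/

section
open Module
variable {F V : Type*} [Field F] [Fintype F] [AddCommGroup V] [Module F V] [FiniteDimensional F V]

/-- Initial contents in general position. -/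
theorem exists_generic_init (n A : ℕ) (hq : 4 ^ n < Fintype.card F) :
    ∃ v : Fin n → Fin A → V, ∀ T : Finset (Fin n),
      min (finrank F V) (T.card * A) ≤ finrank F ↥(T.sup fun s => tupleSpan F (v s)) := by
  obtain ⟨v, -, h⟩ := exists_generic_tuples (F := F) (V := V) (fun _ : Fin n => ⊤) A Finset.univ
    (fun _ : Unit => ⊥) (by simpa using hq)
  refine ⟨v, fun T => ?_⟩
  obtain ⟨N, hN, h⟩ := h () T (Finset.subset_univ _)
  rw [bot_sup_eq, bot_sup_eq] at h
  rcases N.eq_empty_or_nonempty with rfl | ⟨i, hi⟩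
  · rw [Finset.sdiff_empty] at h
    omega
  · have : (N.sup fun _ => (⊤ : Submodule F V)) = ⊤ :=
      top_le_iff.1 (Finset.le_sup (f := fun _ => ⊤) hi)
    rw [this, finrank_top] at h
    omega

/-- Generic contents after all successions of repairs keep the dimensions that the cuts allow. -/
theorem exists_generic_contents {n k d t A B C : ℕ} (ht : 0 < t)
    (hq : 2 ^ n * 2 ^ (n * n) * 4 ^ (n * n) * 4 ^ n < Fintype.card F)
    (hcut : ∀ l : List ℕ, (∀ w ∈ l, w ≤ t) → k ≤ l.sum → finrank F V ≤ cutListNat d t A B C 0 l) :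
    ∃ (v : List (Repair n d t) → Fin n → Fin A → V)
      (c : List (Repair n d t) → Repair n d t → Fin n × Fin n → Fin B → V)
      (e : List (Repair n d t) → Repair n d t → Fin n × Fin n → Fin C → V),
      (∀ h r x i, c h r x i ∈ tupleSpan F (v h x.1)) ∧
      (∀ h r x i, e h r x i ∈ (r.helpers x.1).sup fun p => tupleSpan F (c h r (p, x.1))) ∧
      (∀ h r, ∀ s ∈ r.failed, ∀ i, v (r :: h) s i ∈
        ((r.helpers s).sup fun p => tupleSpan F (c h r (p, s))) ⊔
        (r.failed.erase s).sup fun q => tupleSpan F (e h r (q, s))) ∧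
      (∀ h r, ∀ s ∉ r.failed, v (r :: h) s = v h s) ∧
      ∀ h, ∀ T : Finset (Fin n), T.card = k → (T.sup fun s => tupleSpan F (v h s)) = ⊤ := by
  have hq' : 4 ^ n < Fintype.card F := by
    refine lt_of_le_of_lt ?_ hq
    exact Nat.le_mul_of_pos_left _ (by positivity)
  obtain ⟨v₀, h₀⟩ := exists_generic_init (F := F) (V := V) n A hq'
  choose c e z hc he hz hdim using fun (r : Repair n d t) (τ : Fin n → Fin A → V) =>
    r.exists_generic (fun s => tupleSpan F (τ s)) A B C hq
  let v : List (Repair n d t) → Fin n → Fin A → V := fun h =>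
    List.rec v₀ (fun r _ τ s => if s ∈ r.failed then z r τ s else τ s) h
  have hv : ∀ h r s, v (r :: h) s = if s ∈ r.failed then z r (v h) s else v h s :=
    fun h r s => rfl
  refine ⟨v, fun h r => c r (v h), fun h r => e r (v h), fun h r => hc r (v h),
    fun h r => he r (v h), fun h r s hs => ?_, fun h r s hs => ?_, ?_⟩
  · rw [hv, if_pos hs]
    exact hz r (v h) s
  · rw [hv, if_neg hs]
  -- The devices of `T` lack at most what any admissible continuation of the cut from offset
  -- `T.card` could supply. For `T.card = k` the empty continuation shows that they span everything.
  have inv : ∀ h, ∀ T : Finset (Fin n), ∀ l : List ℕ, (∀ w ∈ l, w ≤ t) → k ≤ T.card + l.sum →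
      finrank F V ≤ finrank F ↥(T.sup fun s => tupleSpan F (v h s)) +
        cutListNat d t A B C T.card l := by
    intro h
    induction h with
    | nil =>
      intro T l hl hk
      have h1 := h₀ T
      change min (finrank F V) (T.card * A) ≤ finrank F ↥(T.sup fun s => tupleSpan F (v [] s)) at h1
      -- Count the initial devices of `T` as groups of size 1, each worth at most `A`.
      have h2 := hcut (List.replicate T.card 1 ++ l) (by
        intro w hw
        rcases List.mem_append.1 hw with hw | hw
        · rw [List.eq_of_mem_replicate hw]; exact ht
        · exact hl w hw) (by simpa using hk)
      rw [cutListNat_append] at h2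
      have h3 : ∀ m s, cutListNat d t A B C s (List.replicate m 1) ≤ m * A := by
        intro m
        induction m with
        | zero => intro s; simp [cutListNat]
        | succ m ih =>
          intro s
          rw [List.replicate_succ, cutListNat, add_mul, one_mul, one_mul, add_comm]
          exact add_le_add (ih _) (min_le_left _ _)
      have h4 := h3 T.card 0
      simp only [List.sum_replicate, smul_eq_mul, mul_one, zero_add] at h2
      omega
    | cons r h ih =>
      intro T l hl hk
      obtain ⟨T', a, b, hba, hat, hbm, hT', h1⟩ := hdim r (v h) T
      have h2 : (T.sup fun s => if s ∈ r.failed then tupleSpan F (z r (v h) s)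
          else tupleSpan F (v h s)) = T.sup fun s => tupleSpan F (v (r :: h) s) := by
        refine Finset.sup_congr rfl fun s _ => ?_
        rw [hv]
        split_ifs <;> rfl
      rw [h2] at h1
      by_cases hTT : T.card ≤ T'.card
      · have h3 := ih T' l hl (by omega)
        have h4 := cutListNat_antitone d t A B C hTT l
        omega
      · have hm := Finset.card_le_card hT'
        have hm' := Finset.card_sdiff_add_card_inter T r.failed
        have hm'' : (T ∩ r.failed).card ≤ t :=
          (Finset.card_le_card Finset.inter_subset_right).trans_eq r.card_failed
        have h5 := min_le_group_cost (u := T.card - T'.card) (x := (d - T'.card) * B)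
          (A := A) (C := C) hba hat hbm (by omega)
        rcases min_le_iff.1 h5 with h6 | h6
        · have h3 := ih T' ((T.card - T'.card) :: l) (by
            intro w hw
            rcases List.mem_cons.1 hw with rfl | hw
            · omega
            · exact hl w hw) (by rw [List.sum_cons]; omega)
          rw [cutListNat, Nat.add_sub_of_le (by omega)] at h3
          omega
        -- A full group may lead past `T.card`; monotonicity in the offset absorbs the excess.
        · have h3 := ih T' (t :: l) (by
            intro w hw
            rcases List.mem_cons.1 hw with rfl | hw
            · exact le_rfl
            · exact hl w hw) (by rw [List.sum_cons]; omega)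
          rw [cutListNat, Nat.sub_self, zero_mul, add_zero] at h3
          have h4 := cutListNat_antitone d t A B C (s := T.card) (s' := T'.card + t) (by omega) l
          omega
  intro h T hT
  refine Submodule.eq_top_of_finrank_eq (le_antisymm (Submodule.finrank_le _) ?_)
  simpa [cutListNat] using inv h T [] (by simp) (by simp [hT])
end

/-! ### From generic functionals to coding schemes -/

/-- A coding scheme with prescribed contents and messages, each of which is a function of the data
it may depend on. -/
theorem exists_codingScheme {n d t : ℕ} {X A B C : Type} [Nonempty A] [Nonempty B] [Nonempty C]
    (cont : List (Repair n d t) → Fin n → X → A)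
    (coll : List (Repair n d t) → Repair n d t → Fin n → Fin n → X → B)
    (coord : List (Repair n d t) → Repair n d t → Fin n → Fin n → X → C)
    (hcoll : ∀ h r p s x y, cont h p x = cont h p y → coll h r p s x = coll h r p s y)
    (hcoord : ∀ h (r : Repair n d t) q s x y,
      (∀ p ∈ r.helpers q, coll h r p q x = coll h r p q y) → coord h r q s x = coord h r q s y)
    (hstore : ∀ h (r : Repair n d t), ∀ s ∈ r.failed, ∀ x y,
      (∀ p ∈ r.helpers s, coll h r p s x = coll h r p s y) →
      (∀ q ∈ r.failed.erase s, coord h r q s x = coord h r q s y) →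
      cont (r :: h) s x = cont (r :: h) s y)
    (hlive : ∀ h (r : Repair n d t), ∀ s ∉ r.failed, cont (r :: h) s = cont h s) :
    ∃ S : CodingScheme n d t X A B C, ∀ x h s, S.contents x h s = cont h s x := by
  -- Every operation is the factor of a prescribed function through the data available, with an
  -- arbitrary value on data that never occur.
  let S : CodingScheme n d t X A B C :=
    { init := cont []
      collect := fun h r p s => Function.extend (cont h p) (coll h r p s)
        fun _ => Classical.arbitrary B
      coordinate := fun h r q s => Function.extend
        (fun x (p : {p // p ∈ r.helpers q}) => coll h r p q x) (coord h r q s)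
        fun _ => Classical.arbitrary C
      store := fun h r s f g => Function.extend
        (fun x => ((fun p => coll h r p s x, fun q => coord h r q s x) :
          ({p // p ∈ r.helpers s} → B) × ({q // q ∈ r.failed.erase s} → C))) (cont (r :: h) s)
        (fun _ => Classical.arbitrary A) (f, g) }
  have h1 : ∀ h r p s x, S.collect h r p s (cont h p x) = coll h r p s x := fun h r p s x =>
    Function.FactorsThrough.extend_apply (g := coll h r p s) (f := cont h p)
      (fun x y hxy => hcoll h r p s x y hxy) (fun _ => Classical.arbitrary B) x
  have h2 : ∀ h r q s x, S.coordinate h r q s (fun p => coll h r p q x) = coord h r q s x :=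
    fun h r q s x => Function.FactorsThrough.extend_apply
      (fun x y hxy => hcoord h r q s x y fun p hp => congrFun hxy ⟨p, hp⟩)
      (fun _ => Classical.arbitrary C) x
  have h3 : ∀ h r, ∀ s ∈ r.failed, ∀ x, S.store h r s (fun p => coll h r p s x)
      (fun q => coord h r q s x) = cont (r :: h) s x :=
    fun h r s hs x => Function.FactorsThrough.extend_apply
      (f := fun x => ((fun p => coll h r p s x, fun q => coord h r q s x) :
          ({p // p ∈ r.helpers s} → B) × ({q // q ∈ r.failed.erase s} → C)))
      (fun x y hxy => hstore h r s hs x y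
        (fun p hp => congrFun (congrArg Prod.fst hxy) ⟨p, hp⟩)
        (fun q hq => congrFun (congrArg Prod.snd hxy) ⟨q, hq⟩))
      (fun _ => Classical.arbitrary A) x
  refine ⟨S, fun x h => ?_⟩
  induction h with
  | nil => intro s; rfl
  | cons r h ih =>
    intro s
    rw [CodingScheme.contents]
    split_ifs with hs
    · simp only [ih, h1, h2]
      exact h3 h r s hs x
    · rw [ih, hlive h r s hs]

open Module in
/-- Linear functionals in a span agree wherever the spanning ones do. -/
theorem Module.Dual.apply_eq_of_mem {F E : Type*} [Field F] [AddCommGroup E] [Module F E]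
    {W : Submodule F (Dual F E)} {x y : E} (hW : W ≤ LinearMap.ker (Dual.eval F E (x - y)))
    {v : Dual F E} (hv : v ∈ W) : v x = v y := by
  have := hW hv
  rwa [LinearMap.mem_ker, Dual.eval_apply, map_sub, sub_eq_zero] at this

open Module in
theorem sup_tupleSpan_le_ker {F E ι : Type*} [Field F] [AddCommGroup E] [Module F E] {a : ℕ}
    {w : ι → Fin a → Dual F E} {x y : E} {N : Finset ι} (h : ∀ i ∈ N, ∀ j, w i j x = w i j y) :
    (N.sup fun i => tupleSpan F (w i)) ≤ LinearMap.ker (Dual.eval F E (x - y)) :=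
  Finset.sup_le fun i hi => tupleSpan_le fun j => by
    rw [LinearMap.mem_ker, Dual.eval_apply, map_sub, sub_eq_zero, h i hi j]

/-- Linear codes over a large field attain the cuts. -/
theorem exists_codingScheme_of_cut {n k d t R A B C : ℕ} (ht : 0 < t)
    (hcut : ∀ l : List ℕ, (∀ w ∈ l, w ≤ t) → k ≤ l.sum → R ≤ cutListNat d t A B C 0 l) :
    ∃ q, 1 < q ∧ ∃ S : CodingScheme n d t (Fin (q ^ R)) (Fin (q ^ A)) (Fin (q ^ B)) (Fin (q ^ C)),
      ∀ L, S.Recovers k L := by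
  obtain ⟨q, hq, hp⟩ := Nat.exists_infinite_primes (2 ^ n * 2 ^ (n * n) * 4 ^ (n * n) * 4 ^ n + 1)
  have : Fact q.Prime := ⟨hp⟩
  have hfr : Module.finrank (ZMod q) (Module.Dual (ZMod q) (Fin R → ZMod q)) = R := by
    rw [Subspace.dual_finrank_eq, Module.finrank_fin_fun]
  obtain ⟨v, c, e, hc, he, hv, hlive, htop⟩ := exists_generic_contents (F := ZMod q)
    (V := Module.Dual (ZMod q) (Fin R → ZMod q)) (n := n) (k := k) (d := d) (A := A) (B := B)
    (C := C) ht (by rw [ZMod.card]; exact hq) (by rw [hfr]; exact hcut)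
  have ex : ∀ m, Nonempty ((Fin m → ZMod q) ≃ Fin (q ^ m)) := fun m =>
    ⟨Fintype.equivFinOfCardEq (by simp [ZMod.card])⟩
  obtain ⟨eX⟩ := ex R
  obtain ⟨eA⟩ := ex A
  obtain ⟨eB⟩ := ex B
  obtain ⟨eC⟩ := ex C
  have hne : ∀ m, Nonempty (Fin (q ^ m)) := fun m => ⟨⟨0, pow_pos hp.pos m⟩⟩
  obtain ⟨S, hS⟩ := exists_codingScheme (n := n) (d := d) (t := t) (X := Fin (q ^ R))
    (fun h s x => eA fun i => v h s i (eX.symm x))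
    (fun h r p s x => eB fun i => c h r (p, s) i (eX.symm x))
    (fun h r q s x => eC fun i => e h r (q, s) i (eX.symm x))
    (fun h r p s x y hxy => congrArg eB (funext fun i => Module.Dual.apply_eq_of_mem
      (by
        have := sup_tupleSpan_le_ker (N := {p}) (w := v h) (x := eX.symm x) (y := eX.symm y)
          (fun i hi j => by
            rw [Finset.mem_singleton.1 hi]; exact congrFun (eA.injective hxy) j)
        rwa [Finset.sup_singleton] at this) (hc h r (p, s) i)))
    (fun h r q s x y hxy => congrArg eC (funext fun i => Module.Dual.apply_eq_of_mem
      (sup_tupleSpan_le_ker fun p hp j => congrFun (eB.injective (hxy p hp)) j)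
      (he h r (q, s) i)))
    (fun h r s hs x y h1 h2 => congrArg eA (funext fun i => Module.Dual.apply_eq_of_mem
      (sup_le (sup_tupleSpan_le_ker fun p hp j => congrFun (eB.injective (h1 p hp)) j)
        (sup_tupleSpan_le_ker fun p hp j => congrFun (eC.injective (h2 p hp)) j))
      (hv h r s hs i)))
    (fun h r s hs => by rw [hlive h r s hs])
  refine ⟨q, hp.one_lt, S, fun L h _ K hK => ?_⟩
  have hinj : Function.Injective fun (x : Fin (q ^ R)) (s : {s // s ∈ K}) => S.contents x h s := by
    intro x y hxy
    have hle := sup_tupleSpan_le_ker (N := K) (w := v h) (x := eX.symm x) (y := eX.symm y)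
      fun s hs j => by
        have := congrFun hxy ⟨s, hs⟩
        simp only [hS] at this
        exact congrFun (eA.injective this) j
    -- The functionals stored in `K` span the dual space, so the coordinates of the two files agree
    -- as well.
    rw [htop h K hK] at hle
    refine eX.symm.injective (funext fun i => ?_)
    exact Module.Dual.apply_eq_of_mem (v := LinearMap.proj i) hle Submodule.mem_top
  have := hne R
  obtain ⟨dec, hdec⟩ := hinj.hasLeftInverse
  exact ⟨dec, hdec⟩

/-! ### Rounding real amounts -/

/-- Rounding loses at most 1 per amount, hence at most `1 + d + t` per device counted in the cut. -/
theorem cutList_floor_bound {d t A B C D s : ℕ} {α β β' : ℝ} {l : List ℕ}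
    (hA : D * α ≤ A + 1) (hB : D * β ≤ B + 1) (hC : D * β' ≤ C + 1) (hs : s + l.sum ≤ d)
    (hl : ∀ w ∈ l, w ≤ t) :
    D * cutList d t α β β' s l ≤ cutList d t A B C s l + l.sum * (1 + d + t) := by
  induction l generalizing s with
  | nil => simp [cutList]
  | cons w l ih =>
    rw [List.sum_cons] at hs
    have h1 := ih (s := s + w) (by omega) fun x hx => hl x (by simp [hx])
    have hd : (0 : ℝ) ≤ d - s := sub_nonneg.2 (by exact_mod_cast (by omega : s ≤ d))
    have ht : (0 : ℝ) ≤ t - w := sub_nonneg.2 (by exact_mod_cast hl w (by simp))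
    have h2 : D * min α ((d - s) * β + (t - w) * β') ≤
        min (A : ℝ) ((d - s) * B + (t - w) * C) + (1 + d + t) := by
      rw [mul_min_of_nonneg _ _ (Nat.cast_nonneg D), ← min_add_add_right]
      refine min_le_min (by linarith [Nat.cast_nonneg (α := ℝ) d, Nat.cast_nonneg (α := ℝ) t]) ?_
      have h3 := mul_le_mul_of_nonneg_left hB hd
      have h4 := mul_le_mul_of_nonneg_left hC ht
      have h5 := Nat.cast_nonneg (α := ℝ) s
      have h6 := Nat.cast_nonneg (α := ℝ) w
      nlinarith
    have h3 := mul_le_mul_of_nonneg_left h2 (Nat.cast_nonneg (α := ℝ) w)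
    simp only [cutList, List.sum_cons]
    push_cast at h1 ⊢
    nlinarith

theorem CutConstraints.isCorrectWith {n k d t : ℕ} {M α β β' : ℝ}
    (h : CutConstraints k d t M α β β') (hk : 0 < k) (ht : 0 < t) (htk : t ∣ k) (hkd : k ≤ d)
    (hM : 0 < M) (hβ : 0 ≤ β) (hβ' : 0 ≤ β') : IsCorrectWith n k d t M α β β' := by
  intro L M' hM'
  -- Groups of size `t` only give `0 < M ≤ k * α`.
  have hα : 0 ≤ α := by
    obtain ⟨m, rfl⟩ := htk
    have h1 := h.le_cutList (l := List.replicate m t) (by simp [mul_comm])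
      fun w hw => (List.eq_of_mem_replicate hw).le
    have h2 : ∀ (l : List ℕ) (s : ℝ), cutList d t α β β' s l ≤ l.sum * α := by
      intro l
      induction l with
      | nil => simp [cutList]
      | cons w l ih =>
        intro s
        have h3 := mul_le_mul_of_nonneg_left
          (min_le_left α (((d : ℝ) - s) * β + ((t : ℝ) - w) * β')) (Nat.cast_nonneg (α := ℝ) w)
        have := ih (s + w)
        rw [cutList, List.sum_cons, Nat.cast_add]
        linarith
    have h3 := hM.trans_le (h1.trans (h2 _ _))
    exact (pos_of_mul_pos_right h3 (Nat.cast_nonneg _)).le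
  -- At scale `D` the gap between `M` and `max M' 0` exceeds the rounding loss `k * (1 + d + t)`
  -- plus 1 for the ceiling of the file size.
  obtain ⟨D, hD⟩ := exists_nat_gt ((k * (1 + d + t) + 1) / (M - max M' 0))
  have hlt : 0 < M - max M' 0 := sub_pos.2 (max_lt hM' hM)
  rw [div_lt_iff₀ hlt] at hD
  have hD0 : 0 < D := by
    rcases Nat.eq_zero_or_pos D with rfl | h0
    · rw [Nat.cast_zero, zero_mul] at hD
      have : (0 : ℝ) ≤ k * (1 + d + t) + 1 := by positivity
      linarith
    · exact h0
  have hfl : ∀ x : ℝ, D * x ≤ ⌊D * x⌋₊ + 1 := fun x => (Nat.lt_floor_add_one _).le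
  have hfl' : ∀ x : ℝ, 0 ≤ x → (⌊D * x⌋₊ : ℝ) ≤ D * x := fun x hx => Nat.floor_le (by positivity)
  have hcut : CutConstraints k d t (⌈D * max M' 0⌉₊ : ℕ) (⌊D * α⌋₊ : ℕ) (⌊D * β⌋₊ : ℕ)
      (⌊D * β'⌋₊ : ℕ) := by
    rw [cutConstraints_iff_list]
    intro l hl hw
    have h1 := cutList_floor_bound (d := d) (t := t) (s := 0) (l := l) (hfl α) (hfl β) (hfl β')
      (by omega) fun w hw' => (hw w hw').2
    have h2 := h.le_cutList hl fun w hw' => (hw w hw').2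
    have h3 := (Nat.ceil_lt_add_one (a := D * max M' 0) (by positivity)).le
    have h4 := mul_le_mul_of_nonneg_left h2 (Nat.cast_nonneg (α := ℝ) D)
    rw [Nat.cast_zero, hl] at h1
    linarith
  obtain ⟨q, hq, S, hS⟩ := exists_codingScheme_of_cut (n := n) (k := k) ht
    fun l hw hl => hcut.le_cutListNat hk hkd htk hl hw
  have hq1 : (1 : ℝ) ≤ q := by exact_mod_cast hq.le
  have hpow : ∀ x : ℝ, ((q ^ D : ℕ) : ℝ) ^ x = (q : ℝ) ^ (D * x) := fun x => by
    rw [Nat.cast_pow, ← Real.rpow_natCast, ← Real.rpow_mul (by positivity)]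
  have hle : ∀ x : ℝ, 0 ≤ x → ((q ^ ⌊D * x⌋₊ : ℕ) : ℝ) ≤ ((q ^ D : ℕ) : ℝ) ^ x := fun x hx => by
    rw [hpow, Nat.cast_pow, ← Real.rpow_natCast]
    exact Real.rpow_le_rpow_of_exponent_le hq1 (hfl' x hx)
  refine ⟨q ^ D, _, _, _, _, Nat.one_lt_pow hD0.ne' hq, ?_, hle α hα, hle β hβ, hle β' hβ', S,
    hS L⟩
  rw [hpow, Nat.cast_pow, ← Real.rpow_natCast]
  refine Real.rpow_le_rpow_of_exponent_le hq1 (le_trans ?_ (Nat.le_ceil _))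
  gcongr
  exact le_max_left _ _

/-! ### Counting contents along a cut -/

/-- If `f` is determined by `f'` and `e`, then it has at most as many values as these together. -/
theorem Nat.card_range_le_mul {X Y Z E : Type*} [Finite Y] [Finite E] (f : X → Z) (f' : X → Y)
    (e : X → E) (h : ∀ x y, f' x = f' y → e x = e y → f x = f y) :
    Nat.card (Set.range f) ≤ Nat.card (Set.range f') * Nat.card E := by
  rw [← Nat.card_prod]
  refine Nat.card_le_card_of_injective (fun z => (⟨f' z.2.choose, z.2.choose, rfl⟩, e z.2.choose))
    fun z w hzw => ?_
  rw [Prod.mk.injEq] at hzw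
  have := h _ _ (congrArg Subtype.val hzw.1) hzw.2
  rw [z.2.choose_spec, w.2.choose_spec] at this
  exact Subtype.ext this

/-- The number of different contents of the devices in the first `s` slots. -/
noncomputable def CodingScheme.numContents {n d t : ℕ} {X A B C : Type}
    (S : CodingScheme n d t X A B C) (h : List (Repair n d t)) (s : ℕ) : ℕ :=
  Nat.card (Set.range fun (x : X) (i : {i : Fin n // (i : ℕ) < s}) => S.contents x h i)

theorem Fin.card_filter_le_lt {n a b : ℕ} (hb : b ≤ n) :
    (Finset.univ.filter fun i : Fin n => a ≤ i ∧ (i : ℕ) < b).card = b - a := by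
  rw [← Nat.card_Ico a b, ← Finset.card_map Fin.valEmbedding]
  congr 1
  ext j
  simp only [Finset.mem_map, Finset.mem_filter, Finset.mem_univ, true_and, Finset.mem_Ico,
    Fin.valEmbedding_apply]
  exact ⟨fun ⟨i, hi, hij⟩ => hij ▸ hi, fun hj => ⟨⟨j, by omega⟩, hj, rfl⟩⟩

/-- The repair of the slots from `s` to `s + w` along the cut: further failures are outside of the
first `k` slots, and all helpers of the first `s` slots are contacted. -/
theorem exists_cut_repair {n k d t s w : ℕ} (hkd : k ≤ d) (hn : d + t ≤ n) (hs : s + w ≤ k)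
    (hw : w ≤ t) : ∃ r : Repair n d t,
      (∀ i : Fin n, (i : ℕ) < s + w → (i ∈ r.failed ↔ s ≤ i)) ∧
      ∀ q, ∀ i : Fin n, (i : ℕ) < s → i ∈ r.helpers q := by
  let U := Finset.univ.filter fun i : Fin n => s ≤ i ∧ (i : ℕ) < s + w
  -- These slots exist because `k + (t - w) ≤ d + t ≤ n`.
  let E := Finset.univ.filter fun i : Fin n => k ≤ i ∧ (i : ℕ) < k + (t - w)
  have hUE : Disjoint U E := Finset.disjoint_left.2 fun i hi hi' => by
    simp only [U, E, Finset.mem_filter, Finset.mem_univ, true_and] at hi hi'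
    omega
  have hF : (U ∪ E).card = t := by
    rw [Finset.card_union_of_disjoint hUE, Fin.card_filter_le_lt (by omega),
      Fin.card_filter_le_lt (by omega)]
    omega
  have hmem : ∀ i : Fin n, (i : ℕ) < s + w → (i ∈ U ∪ E ↔ s ≤ i) := fun i hi => by
    simp only [U, E, Finset.mem_union, Finset.mem_filter, Finset.mem_univ, true_and]
    omega
  let P := Finset.univ.filter fun i : Fin n => 0 ≤ (i : ℕ) ∧ (i : ℕ) < s
  have hP : P ⊆ (U ∪ E)ᶜ := fun i hi => by
    simp only [P, Finset.mem_filter, Finset.mem_univ, true_and] at hi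
    rw [Finset.mem_compl, hmem i (by omega)]
    omega
  obtain ⟨H, hPH, hHF, hH⟩ := Finset.exists_subsuperset_card_eq hP (n := d)
    (by rw [Fin.card_filter_le_lt (by omega)]; omega)
    (by rw [Finset.card_compl, hF, Fintype.card_fin]; omega)
  refine ⟨⟨U ∪ E, fun _ => H, hF, fun _ _ => hH, fun _ _ => ?_⟩, hmem, fun q i hi => hPH ?_⟩
  · exact (Finset.disjoint_left.2 fun i hi => Finset.mem_compl.1 (hHF hi))
  · simpa [P] using hi

section
variable {n k d t a b c : ℕ} {X : Type}

/-- The earlier slots are unchanged. The repaired ones are determined either by their `w` new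
contents, or by the earlier slots and, for each of the `w` devices, the messages from `d - s`
further helpers and `t - w` other new devices. -/
theorem CodingScheme.numContents_repair_le (S : CodingScheme n d t X (Fin a) (Fin b) (Fin c))
    (h : List (Repair n d t)) (r : Repair n d t) {s w : ℕ}
    (hr : ∀ i : Fin n, (i : ℕ) < s + w → (i ∈ r.failed ↔ s ≤ i))
    (hr' : ∀ q, ∀ i : Fin n, (i : ℕ) < s → i ∈ r.helpers q) (hn : s + w ≤ n) :
    S.numContents (r :: h) (s + w) ≤ S.numContents h s * a ^ w ∧
    S.numContents (r :: h) (s + w) ≤ S.numContents h s * (b ^ (d - s) * c ^ (t - w)) ^ w := by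
  have hlive : ∀ x (i : Fin n), (i : ℕ) < s → S.contents x (r :: h) i = S.contents x h i := by
    intro x i hi
    rw [CodingScheme.contents, if_neg]
    rw [hr i (by omega)]
    omega
  let P := Finset.univ.filter fun i : Fin n => 0 ≤ (i : ℕ) ∧ (i : ℕ) < s
  let U := Finset.univ.filter fun i : Fin n => s ≤ i ∧ (i : ℕ) < s + w
  have hP : ∀ i, i ∈ P ↔ (i : ℕ) < s := fun i => by simp [P]
  have hU : ∀ i, i ∈ U ↔ s ≤ i ∧ (i : ℕ) < s + w := fun i => by simp [U]
  have hPc : P.card = s := (Fin.card_filter_le_lt (by omega)).trans (by omega)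
  have hUc : U.card = w := (Fin.card_filter_le_lt (by omega)).trans (by omega)
  have hUf : U ⊆ r.failed := fun i hi => (hr i ((hU i).1 hi).2).2 ((hU i).1 hi).1
  constructor
  · have h1 := Nat.card_range_le_mul
      (fun (x : X) (i : {i : Fin n // (i : ℕ) < s + w}) => S.contents x (r :: h) i)
      (fun (x : X) (i : {i : Fin n // (i : ℕ) < s}) => S.contents x h i)
      (fun x (i : U) => S.contents x (r :: h) i) (fun x y h1 h2 => by
        refine funext fun ⟨i, hi⟩ => ?_
        by_cases his : (i : ℕ) < s
        · simp only [hlive _ i his]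
          exact congrFun h1 ⟨i, his⟩
        · exact congrFun h2 ⟨i, (hU i).2 ⟨not_lt.1 his, hi⟩⟩)
    refine h1.trans_eq ?_
    rw [Nat.card_fun, Nat.card_fin, Nat.card_eq_fintype_card (α := U), Fintype.card_coe, hUc]
    rfl
  · have h1 := Nat.card_range_le_mul
      (fun (x : X) (i : {i : Fin n // (i : ℕ) < s + w}) => S.contents x (r :: h) i)
      (fun (x : X) (i : {i : Fin n // (i : ℕ) < s}) => S.contents x h i)
      (E := ∀ i : U, (↥(r.helpers i \ P) → Fin b) × (↥(r.failed \ U) → Fin c))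
      (fun x i => (fun p => S.collect h r p i (S.contents x h p),
        fun q => S.coordinate h r q i fun p => S.collect h r p q (S.contents x h p)))
      (fun x y h1 h2 => by
        have hcoll : ∀ i ∈ U, ∀ p ∈ r.helpers i,
            S.collect h r p i (S.contents x h p) = S.collect h r p i (S.contents y h p) := by
          intro i hi p hp
          by_cases hps : (p : ℕ) < s
          · exact congrArg _ (congrFun h1 ⟨p, hps⟩)
          · exact congrFun (congrArg Prod.fst (congrFun h2 ⟨i, hi⟩))
              ⟨p, Finset.mem_sdiff.2 ⟨hp, fun hh => hps ((hP p).1 hh)⟩⟩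
        refine funext fun ⟨i, hi⟩ => ?_
        by_cases his : (i : ℕ) < s
        · simp only [hlive _ i his]
          exact congrFun h1 ⟨i, his⟩
        · have hiU : i ∈ U := (hU i).2 ⟨not_lt.1 his, hi⟩
          simp only [CodingScheme.contents, if_pos (hUf hiU)]
          congr 1
          · exact funext fun p => hcoll i hiU p p.2
          · refine funext fun q => ?_
            -- Exchanges inside the group cost nothing, since all that its members collect is
            -- already known.
            by_cases hq : q.1 ∈ U
            · exact congrArg _ (funext fun p => hcoll q hq p p.2)
            · exact congrFun (congrArg Prod.snd (congrFun h2 ⟨i, hiU⟩))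
                ⟨q, Finset.mem_sdiff.2 ⟨Finset.mem_of_mem_erase q.2, hq⟩⟩)
    refine h1.trans_eq ?_
    have hE : ∀ i : U, Nat.card ((↥(r.helpers i \ P) → Fin b) × (↥(r.failed \ U) → Fin c)) =
        b ^ (d - s) * c ^ (t - w) := by
      intro i
      rw [Nat.card_prod, Nat.card_fun, Nat.card_fun]
      simp only [Nat.card_eq_fintype_card, Fintype.card_coe, Fintype.card_fin]
      rw [Finset.card_sdiff_of_subset hUf, Finset.card_sdiff_of_subset
        (fun p hp => hr' i p ((hP p).1 hp)), r.card_failed, r.card_helpers i (hUf i.2), hUc, hPc]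
    rw [Nat.card_pi, Finset.prod_congr rfl fun i _ => hE i, Finset.prod_const, Finset.card_univ,
      Fintype.card_coe, hUc]
    rfl

theorem CodingScheme.exists_numContents_le (S : CodingScheme n d t X (Fin a) (Fin b) (Fin c))
    (hkd : k ≤ d) (hn : d + t ≤ n) {Q : ℕ} (hQ : 1 < Q) {α β β' : ℝ} (ha : (a : ℝ) ≤ (Q : ℝ) ^ α)
    (hb : (b : ℝ) ≤ (Q : ℝ) ^ β) (hc : (c : ℝ) ≤ (Q : ℝ) ^ β') (l : List ℕ)
    (hl : ∀ w ∈ l, w ≤ t) (s : ℕ) (hs : s + l.sum ≤ k) (h : List (Repair n d t)) :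
    ∃ h' : List (Repair n d t), h'.length = h.length + l.length ∧
      (S.numContents h' (s + l.sum) : ℝ) ≤
        S.numContents h s * (Q : ℝ) ^ cutList d t α β β' s l := by
  have hQ0 : (0 : ℝ) < Q := by positivity
  induction l generalizing s h with
  | nil => exact ⟨h, by simp, by simp [cutList]⟩
  | cons w l ih =>
    rw [List.sum_cons] at hs
    have hw := hl w (by simp)
    obtain ⟨r, hr, hr'⟩ := exists_cut_repair (n := n) (s := s) (w := w) hkd hn (by omega) hw
    obtain ⟨h1, h2⟩ := S.numContents_repair_le h r hr hr' (by omega)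
    obtain ⟨h', hlen, h3⟩ := ih (fun x hx => hl x (by simp [hx])) (s + w) (by omega) (r :: h)
    refine ⟨h', by simp [hlen]; omega, ?_⟩
    rw [List.sum_cons, ← add_assoc]
    refine h3.trans ?_
    rw [cutList, Real.rpow_add hQ0, ← mul_assoc, Nat.cast_add]
    refine mul_le_mul_of_nonneg_right ?_ (by positivity)
    have e1 : (a : ℝ) ^ w ≤ (Q : ℝ) ^ (w * α) := by
      rw [mul_comm, Real.rpow_mul_natCast hQ0.le]
      gcongr
    have e2 : ((b : ℝ) ^ (d - s) * (c : ℝ) ^ (t - w)) ^ w ≤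
        (Q : ℝ) ^ (w * ((d - s) * β + (t - w) * β')) := by
      rw [mul_comm (w : ℝ), Real.rpow_mul_natCast hQ0.le, Real.rpow_add hQ0,
        ← Nat.cast_sub (by omega : s ≤ d), ← Nat.cast_sub hw, mul_comm _ β, mul_comm _ β',
        Real.rpow_mul_natCast hQ0.le, Real.rpow_mul_natCast hQ0.le]
      gcongr
    rcases le_total α ((d - s) * β + (t - w) * β') with hm | hm
    · rw [min_eq_left hm]
      calc (S.numContents (r :: h) (s + w) : ℝ) ≤ S.numContents h s * (a : ℝ) ^ w := by
            exact_mod_cast h1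
        _ ≤ _ := by gcongr
    · rw [min_eq_right hm]
      calc (S.numContents (r :: h) (s + w) : ℝ) ≤
            S.numContents h s * ((b : ℝ) ^ (d - s) * (c : ℝ) ^ (t - w)) ^ w := by
            exact_mod_cast h2
        _ ≤ _ := by gcongr
end

theorem IsCorrectWith.cutConstraints {n k d t : ℕ} {M α β β' : ℝ}
    (h : IsCorrectWith n k d t M α β β') (hkd : k ≤ d) (hn : d + t ≤ n) :
    CutConstraints k d t M α β β' := by
  rw [cutConstraints_iff_list]
  intro l hl hw
  refine le_of_forall_lt fun M' hM' => ?_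
  by_contra hcon
  -- Correctness supplies only file sizes below `M`, so one strictly above `M'` is used to get a
  -- strict contradiction.
  obtain ⟨M'', h1, h2⟩ := exists_between hM'
  obtain ⟨Q, N, a, b, c, hQ, hN, ha, hb, hc, S, hS⟩ := h l.length M'' h2
  have hQ1 : (1 : ℝ) < Q := by exact_mod_cast hQ
  obtain ⟨h', hlen, h3⟩ := S.exists_numContents_le hkd hn hQ ha hb hc l
    (fun w hw' => (hw w hw').2) 0 (by omega) []
  obtain ⟨dec, hdec⟩ := hS h' (by simp [hlen])
    (Finset.univ.filter fun i : Fin n => 0 ≤ (i : ℕ) ∧ (i : ℕ) < k)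
    (Fin.card_filter_le_lt (by omega))
  have h4 : S.numContents [] 0 ≤ 1 := by
    refine Finite.card_le_one_iff_subsingleton.2 ⟨fun z w => Subtype.ext (funext fun i => ?_)⟩
    exact absurd i.2 (Nat.not_lt_zero _)
  have h5 : N ≤ S.numContents h' k := by
    refine (Nat.card_fin N).symm.trans_le ?_
    refine Nat.card_le_card_of_injective _ (Set.rangeFactorization_injective.2 fun x y hxy => ?_)
    rw [← hdec x, ← hdec y]
    exact congrArg dec (funext fun i => congrFun hxy ⟨i, (Finset.mem_filter.1 i.2).2.2⟩)
  rw [zero_add, hl, Nat.cast_zero] at h3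
  have h6 : (Q : ℝ) ^ M'' ≤ (Q : ℝ) ^ cutList d t α β β' 0 l := by
    refine hN.trans ((Nat.cast_le.2 h5).trans (h3.trans ?_))
    refine mul_le_of_le_one_left (by positivity) (by exact_mod_cast h4)
  have := (Real.rpow_le_rpow_left_iff hQ1).1 h6
  linarith

theorem theorem1 (n k d t : ℕ) (M : ℝ) (hk : 0 < k) (ht : 0 < t) (htk : t ∣ k) (hkd : k ≤ d)
    (hn : d + t ≤ n) (hM : 0 < M) :
    (∀ α β β' : ℝ, 0 ≤ β → 0 ≤ β' →
      (IsCorrectWith n k d t M α β β' ↔ CutConstraints k d t M α β β')) ∧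
    (∀ α γ : ℝ, IsCorrect n k d t M α γ ↔
      ∃ β β' : ℝ, IsRepairCost d t γ β β' ∧ CutConstraints k d t M α β β') ∧
    (∀ α γ : ℝ, IsMinimalFeasible k d t M α γ → IsOptimal n k d t M α γ) := by
  have h1 : ∀ α β β' : ℝ, 0 ≤ β → 0 ≤ β' →
      (IsCorrectWith n k d t M α β β' ↔ CutConstraints k d t M α β β') := fun α β β' hβ hβ' =>
    ⟨fun h => h.cutConstraints hkd hn, fun h => h.isCorrectWith hk ht htk hkd hM hβ hβ'⟩
  have h2 : ∀ α γ : ℝ, IsCorrect n k d t M α γ ↔ IsFeasible k d t M α γ := fun α γ =>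
    exists_congr fun β => exists_congr fun β' => and_congr_right fun hc =>
      h1 α β β' hc.1 hc.2.1
  exact ⟨h1, h2, fun α γ h => ⟨(h2 α γ).2 h.1, fun α' γ' hlt hc => h.2 α' γ' hlt ((h2 α' γ').1 hc)⟩⟩
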